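/- All graphs are finite, simple and undirected. **Halin graphs.** A *generalized Halin graph* $H(T,C)$ is obtained from a planar embedding of a finite tree $T$ with maximum degree at least $3$ by connecting all leaves of $T$ by a cycle $C$, in the cyclic order in which they occur around the embedded tree. A *Halin graph* is a generalized Halin graph with no vertex of degree two. **Lin-Lu-Yau curvature.** Let $G=(V,E)$ be a connected graph with combinatorial distance $d$. For $x\in V$ of degree $d_x$ and $\alpha\in[0,1]$ let $m_x^\alpha(x)=\alpha$, $m_x^\alpha(v)=(1-\alpha)/d_x$ if $v$ is a neighbour of $x$, and $m_x^\alpha(v)=0$ otherwise. Put $W(m_1,m_2)=\inf_\pi\sum_{x,y\in V}\pi(x,y)\,d(x,y)$, where $\pi$ runs over all maps $V\times V\to[0,1]$ with $\sum_{y}\pi(x,y)=m_1(x)$ for all $x$ and $\sum_{x}\pi(x,y)=m_2(y)$ for all $y$. The Lin-Lu-Yau curvature of an edge $\{x,y\}$ is $$\kappa_{LLY}(x,y)=\lim_{\alpha\to1^-}\frac{1-W(m_x^\alpha,m_y^\alpha)}{1-\alpha}.$$ $G$ has positive Lin-Lu-Yau curvature if $\kappa_{LLY}(x,y)>0$ for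 every edge $\{x,y\}$. **Corollary 1.4 (Halin graph classification).** Let $G$ be a Halin graph with positive Lin-Lu-Yau curvature. Then $G$ is isomorphic to one of the following graphs: - a wheel $W_n$ with $4\le n\le 12$, where $W_n$ is the graph on $n$ vertices obtained by joining one vertex to all vertices of a cycle of length $n-1$; - the graph $H_3$ with vertices $0,\dots,5$ and edges $01,02,03,14,15,23,34,45,52$ (the triangular prism); - the graph $H_7$ with vertices $0,\dots,6$ and edges $01,02,03,04,15,16,23,34,45,56,62$. -/

import Mathlib

namespace HalinLLY

/-! ### Lin-Lu-Yau curvature of a finite graph -/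

section Curvature

variable {V : Type*} [Fintype V]

/-- The measure `m_x^α`: mass `α` at `x` and mass `(1 - α) / d_x` at every neighbour of `x`. -/
noncomputable def walkMeasure (G : SimpleGraph V) (α : ℝ) (x v : V) : ℝ :=
  open Classical in
  if v = x then α else if G.Adj x v then (1 - α) / (G.degree x : ℝ) else 0

/-- `π` is a transport plan from `m₁` to `m₂`: it takes values in `[0, 1]` and has
marginals `m₁` and `m₂`. -/
structure IsTransportPlan (m₁ m₂ : V → ℝ) (π : V → V → ℝ) : Prop where
  mem_unit : ∀ x y, π x y ∈ Set.Icc (0 : ℝ) 1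
  fst_marginal : ∀ x, m₁ x = ∑ y, π x y
  snd_marginal : ∀ y, m₂ y = ∑ x, π x y

/-- The Wasserstein distance between two probability measures with respect to the
combinatorial distance of `G`. -/
noncomputable def wasserstein (G : SimpleGraph V) (m₁ m₂ : V → ℝ) : ℝ :=
  sInf {c : ℝ | ∃ π : V → V → ℝ, IsTransportPlan m₁ m₂ π ∧
    c = ∑ y, ∑ x, π x y * (G.dist x y : ℝ)}

/-- The `α`-Ollivier-Ricci curvature `κ_α(x, y)` of an edge. -/
noncomputable def ollivierCurvature (G : SimpleGraph V) (α : ℝ) (x y : V) : ℝ :=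
  1 - wasserstein G (walkMeasure G α x) (walkMeasure G α y)

/-- `κ` is the Lin-Lu-Yau curvature of the edge `xy`: the limit of `κ_α(x, y) / (1 - α)` as
`α → 1`, where `α` ranges over `[0, 1)`. -/
def HasLLYCurvature (G : SimpleGraph V) (x y : V) (κ : ℝ) : Prop :=
  Filter.Tendsto (fun α : ℝ => ollivierCurvature G α x y / (1 - α))
    (nhdsWithin 1 (Set.Iio 1)) (nhds κ)

/-- Every edge of `G` has positive Lin-Lu-Yau curvature. -/
def HasPositiveLLYCurvature (G : SimpleGraph V) : Prop :=
  ∀ x y, G.Adj x y → ∃ κ : ℝ, HasLLYCurvature G x y κ ∧ 0 < κ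

end Curvature

/-! ### Embeddings of graphs in the plane, up to homeomorphism -/

section Embedding

variable {V : Type*}

/-- A rotation system on `T`: a permutation of the darts (oriented edges) of `T` whose cycles are
exactly the sets of darts with a common source. It gives, at every vertex, the clockwise cyclic
order of the edges around the vertex, and so describes a cellular embedding of a connected graph
in an oriented closed surface up to homeomorphism. -/
structure RotationSystem (T : SimpleGraph V) where
  rot : Equiv.Perm T.Dart
  sameCycle_iff : ∀ d e : T.Dart, rot.SameCycle d e ↔ d.fst = e.fst

namespace RotationSystem

variable {T : SimpleGraph V}

/-- One step along the boundary of a face: cross the dart `d = (u, v)` from `u` to `v` and leave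
`v` through the dart which follows `(v, u)` in the rotation at `v`. -/
def faceStep (ρ : RotationSystem T) : Equiv.Perm T.Dart :=
  (Function.Involutive.toPerm SimpleGraph.Dart.symm SimpleGraph.Dart.symm_involutive).trans ρ.rot

/-- The faces of the embedding, as the orbits of darts under `faceStep`. -/
def Face (ρ : RotationSystem T) : Type _ :=
  Quotient (Equiv.Perm.SameCycle.setoid ρ.faceStep)

/-- The surface of the embedding of the connected graph `T` is the sphere, that is, the embedding
is a planar one: Euler's formula `|V| + |F| = |E| + 2`. -/
def IsPlanar (ρ : RotationSystem T) : Prop :=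
  Nat.card V + Nat.card ρ.Face = T.edgeSet.ncard + 2

end RotationSystem

end Embedding

/-! ### Halin graphs -/

section Halin

variable {V : Type*} [Fintype V]

/-- A leaf is a vertex of degree one. -/
def IsLeaf (T : SimpleGraph V) (v : V) : Prop :=
  open Classical in T.degree v = 1

/-- `b` is the first leaf met after the leaf `a` when one walks around the embedded tree `T`, along
the boundary of its only face, starting at `a`. -/
def NextLeaf {T : SimpleGraph V} (ρ : RotationSystem T) (a b : V) : Prop :=
  IsLeaf T a ∧ IsLeaf T b ∧ ∃ (d : T.Dart) (k : ℕ), d.fst = a ∧ 0 < k ∧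
    ((ρ.faceStep ^ k) d).fst = b ∧
    ∀ j, 0 < j → j < k → ¬ IsLeaf T ((ρ.faceStep ^ j) d).fst

/-- The cycle `C` through all leaves of the embedded tree `T`, in the cyclic order in which
they lie around `T`. -/
def leafCycle {T : SimpleGraph V} (ρ : RotationSystem T) : SimpleGraph V :=
  SimpleGraph.fromRel (NextLeaf ρ)

/-- `G` is a generalized Halin graph `H(T, C)`: it is the union of a tree `T` with maximum degree at
least three, embedded in the plane, and of the cycle `C` connecting the leaves of `T`. -/
def IsGeneralizedHalin (G : SimpleGraph V) : Prop :=
  open Classical in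
  ∃ T : SimpleGraph V, T.IsTree ∧ 3 ≤ T.maxDegree ∧
    ∃ ρ : RotationSystem T, ρ.IsPlanar ∧ G = T ⊔ leafCycle ρ

/-- A Halin graph is a generalized Halin graph without vertices of degree two. -/
def IsHalin (G : SimpleGraph V) : Prop :=
  open Classical in
  IsGeneralizedHalin G ∧ ∀ v, G.degree v ≠ 2

end Halin

/-! ### The graphs in the classification -/

/-- The wheel `W_n` with `n ≥ 4` vertices: the hub `none` is joined to all vertices of a cycle of
length `n - 1`. -/
def wheelGraph (n : ℕ) : SimpleGraph (Option (Fin (n - 1))) :=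
  SimpleGraph.fromRel fun u v =>
    match u, v with
    | none, some _ => True
    | some i, some j => (SimpleGraph.cycleGraph (n - 1)).Adj i j
    | _, _ => False

/-- The triangular prism. It is the Halin graph of the tree with the two inner vertices `0` and `1`,
joined to each other, where `0` has the leaves `2, 3` and `1` has the leaves `4, 5`; the leaves form
the cycle `2, 3, 4, 5`. -/
def H3 : SimpleGraph (Fin 6) :=
  SimpleGraph.fromEdgeSet
    {s(0, 1), s(0, 2), s(0, 3), s(1, 4), s(1, 5),
     s(2, 3), s(3, 4), s(4, 5), s(5, 2)}

/-- The Halin graph of the tree with the two inner vertices `0` and `1`, joined to each other, where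
`0` has the leaves `2, 3, 4` and `1` has the leaves `5, 6`; the leaves form the cycle
`2, 3, 4, 5, 6`. -/
def H7 : SimpleGraph (Fin 7) :=
  SimpleGraph.fromEdgeSet
    {s(0, 1), s(0, 2), s(0, 3), s(0, 4), s(1, 5), s(1, 6),
     s(2, 3), s(3, 4), s(4, 5), s(5, 6), s(6, 2)}

end HalinLLY

/-!
A function `f` which changes by at most one along every edge, and increases by one along the edge
`xy`, bounds the curvature of `xy` from above by `Δf(x) - Δf(y)`, where `Δ` is the normalized
Laplacian: this is the easy half of Kantorovich duality (`HasLLYCurvature.le_laplacian_sub`). So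
nonpositive curvature is shown by writing down one such function.

The face walk around the embedded tree `T` is a cyclic permutation of the darts, and its
first-return map to the darts leaving a leaf is again cyclic. Hence the leaves form a periodic
sequence `x : ℤ → V`, in which two members agree exactly if their indices are congruent modulo the
number `L` of leaves (`RotationSystem.IsPlanar.exists_leaf_enumeration`). If an inner vertex `p`
has a single inner neighbour `q`, then the rotation at `p`, read from `q` on, shows that the
leaves at `p` form an arc `x i, x (i + 1), …` of at least two leaves
(`RotationSystem.exists_fan`).

If `T` has at least two inner vertices, then at least two of them, `p` and `p'`, have a single
inner neighbour. Consider the edge of the leaf cycle from the first leaf `x i` of the arc of `p`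
to its predecessor `x (i - 1)`. Its curvature is nonpositive if `L ≥ 6` (`leafCount_le_five`), and
also if `L = 5` and the tree neighbour of `x (i - 1)` is not adjacent to `p` (`adj_of_fan`). Since
the two arcs are disjoint, the first fact leaves `L = 4` and `L = 5`. If `L = 4`, an edge count
(`ncard_inner_add_two_le`) leaves only two inner vertices. If `L = 5`, the two arcs have two or
three leaves each, and the second fact, used at both arcs, shows that `p` and `p'` are adjacent.
Either way `T` is a double star with four or five leaves, and `G` is `H3` or `H7`.

If `T` has one inner vertex, `G` is a wheel, and the distance to an arc of three rim vertices shows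
that a spoke ending in the middle of the arc has curvature at most `8 / L - 2 / 3`, which excludes
`L ≥ 12` (`leafCount_le_eleven`).
-/

namespace HalinLLY

/-! ### Upper bounds for the curvature from Lipschitz functions -/

section Curvature

variable {V : Type*} [Fintype V] {G : SimpleGraph V}

/-- The normalized graph Laplacian of `f` at `x`: the average of `f v - f x` over the
neighbours `v` of `x`. -/
noncomputable def laplacian (G : SimpleGraph V) (f : V → ℝ) (x : V) : ℝ :=
  open Classical in (∑ v, if G.Adj x v then f v - f x else 0) / (G.degree x : ℝ)

theorem sum_walkMeasure_mul {x : V} (hx : ∃ v, G.Adj x v) (α : ℝ) (f : V → ℝ) :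
    ∑ v, walkMeasure G α x v * f v = f x + (1 - α) * laplacian G f x := by
  classical
  have hdeg : (G.degree x : ℝ) ≠ 0 := by
    have := (G.degree_pos_iff_exists_adj x).2 hx
    positivity
  have h1 : ∀ v, walkMeasure G α x v * f v =
      (if v = x then α * f x else 0) +
        ((1 - α) / G.degree x * (if G.Adj x v then f v - f x else 0) +
          (1 - α) / G.degree x * f x * (if G.Adj x v then 1 else 0)) := by
    intro v
    unfold walkMeasure
    by_cases hvx : v = x
    · subst hvx
      simp
    · by_cases hadj : G.Adj x v
      · simp only [hvx, hadj, if_true, if_false]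
        ring
      · simp [hvx, hadj]
  have h2 : ∑ v, (if G.Adj x v then (1 : ℝ) else 0) = G.degree x := by
    rw [Finset.sum_boole, ← G.card_neighborFinset_eq_degree, G.neighborFinset_eq_filter]
  rw [Finset.sum_congr rfl fun v _ => h1 v, Finset.sum_add_distrib, Finset.sum_add_distrib,
    ← Finset.mul_sum, ← Finset.mul_sum, h2]
  unfold laplacian
  simp only [Finset.sum_ite_eq', Finset.mem_univ, if_true]
  field_simp
  ring

theorem sum_walkMeasure {x : V} (hx : ∃ v, G.Adj x v) (α : ℝ) :
    ∑ v, walkMeasure G α x v = 1 := by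
  simpa [laplacian] using sum_walkMeasure_mul hx α (fun _ => 1)

theorem walkMeasure_nonneg {α : ℝ} (h0 : 0 ≤ α) (h1 : α ≤ 1) (x v : V) :
    0 ≤ walkMeasure G α x v := by
  unfold walkMeasure
  split_ifs
  · exact h0
  · exact div_nonneg (by linarith) (Nat.cast_nonneg _)
  · exact le_rfl

theorem walkMeasure_le_one {α : ℝ} (h0 : 0 ≤ α) (h1 : α ≤ 1) {x : V} (hx : ∃ v, G.Adj x v)
    (v : V) : walkMeasure G α x v ≤ 1 := by
  rw [← sum_walkMeasure hx α]
  exact Finset.single_le_sum (f := walkMeasure G α x)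
    (fun w _ => walkMeasure_nonneg h0 h1 x w) (Finset.mem_univ v)

theorem sub_le_dist_of_adj {V : Type*} {G : SimpleGraph V} (hc : G.Connected) {f : V → ℝ}
    (hf : ∀ u v, G.Adj u v → f v - f u ≤ 1) (u v : V) : f v - f u ≤ G.dist u v := by
  obtain ⟨p, hp⟩ := hc.exists_walk_length_eq_dist u v
  rw [← hp]
  clear hp
  induction p with
  | nil => simp
  | cons h p ih =>
    have := hf _ _ h
    rw [SimpleGraph.Walk.length_cons]
    push_cast
    linarith

/-- The easy half of Kantorovich duality. The product measure is used to see that the infimum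
defining the Wasserstein distance is over a nonempty set. -/
theorem sub_sum_le_wasserstein (hc : G.Connected) {x y : V} (hx : ∃ v, G.Adj x v)
    (hy : ∃ v, G.Adj y v) {α : ℝ} (h0 : 0 ≤ α) (h1 : α ≤ 1) {f : V → ℝ}
    (hf : ∀ u v, G.Adj u v → f v - f u ≤ 1) :
    ∑ v, walkMeasure G α y v * f v - ∑ v, walkMeasure G α x v * f v ≤
      wasserstein G (walkMeasure G α x) (walkMeasure G α y) := by
  unfold wasserstein
  apply le_csInf
  · refine ⟨_, fun u v => walkMeasure G α x u * walkMeasure G α y v, ⟨?_, ?_, ?_⟩, rfl⟩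
    · intro u v
      exact ⟨mul_nonneg (walkMeasure_nonneg h0 h1 _ _) (walkMeasure_nonneg h0 h1 _ _),
        mul_le_one₀ (walkMeasure_le_one h0 h1 hx _) (walkMeasure_nonneg h0 h1 _ _)
          (walkMeasure_le_one h0 h1 hy _)⟩
    · intro u
      rw [← Finset.mul_sum, sum_walkMeasure hy, mul_one]
    · intro v
      rw [← Finset.sum_mul, sum_walkMeasure hx, one_mul]
  · rintro c ⟨π, hπ, rfl⟩
    have e1 : ∑ v, walkMeasure G α y v * f v = ∑ v, ∑ u, π u v * f v :=
      Finset.sum_congr rfl fun v _ => by rw [hπ.snd_marginal, Finset.sum_mul]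
    have e2 : ∑ u, walkMeasure G α x u * f u = ∑ v, ∑ u, π u v * f u := by
      rw [Finset.sum_comm]
      exact Finset.sum_congr rfl fun v _ => by rw [hπ.fst_marginal, Finset.sum_mul]
    rw [e1, e2, ← Finset.sum_sub_distrib]
    refine Finset.sum_le_sum fun v _ => ?_
    rw [← Finset.sum_sub_distrib]
    refine Finset.sum_le_sum fun u _ => ?_
    rw [← mul_sub]
    exact mul_le_mul_of_nonneg_left (sub_le_dist_of_adj hc hf u v) (hπ.mem_unit u v).1

/-- Every `1`-Lipschitz function which increases by `1` along the edge `xy` bounds the curvature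
of that edge from above. -/
theorem HasLLYCurvature.le_laplacian_sub (hc : G.Connected) {x y : V} (hxy : G.Adj x y) {κ : ℝ}
    (hκ : HasLLYCurvature G x y κ) {f : V → ℝ} (hf : ∀ u v, G.Adj u v → f v - f u ≤ 1)
    (hfxy : f y = f x + 1) : κ ≤ laplacian G f x - laplacian G f y := by
  refine le_of_tendsto hκ ?_
  filter_upwards [Ioo_mem_nhdsLT (show (0 : ℝ) < 1 by norm_num)] with α hα
  have h := sub_sum_le_wasserstein hc ⟨y, hxy⟩ ⟨x, hxy.symm⟩ hα.1.le hα.2.le hf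
  rw [sum_walkMeasure_mul ⟨y, hxy⟩, sum_walkMeasure_mul ⟨x, hxy.symm⟩, hfxy] at h
  rw [div_le_iff₀ (by linarith [hα.2])]
  unfold ollivierCurvature
  linarith

theorem HasPositiveLLYCurvature.laplacian_lt (hpos : HasPositiveLLYCurvature G)
    (hc : G.Connected) {x y : V} (hxy : G.Adj x y) {f : V → ℝ}
    (hf : ∀ u v, G.Adj u v → f v - f u ≤ 1) (hfxy : f y = f x + 1) :
    laplacian G f y < laplacian G f x := by
  obtain ⟨κ, hκ, h0⟩ := hpos x y hxy
  linarith [hκ.le_laplacian_sub hc hxy hf hfxy]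

theorem laplacian_of_three {x a b c : V} (hab : a ≠ b) (hac : a ≠ c) (hbc : b ≠ c)
    (h : ∀ v, G.Adj x v ↔ v = a ∨ v = b ∨ v = c) (f : V → ℝ) :
    laplacian G f x = (f a + f b + f c - 3 * f x) / 3 := by
  classical
  have hN : Finset.univ.filter (G.Adj x) = {a, b, c} := by
    ext v
    simp [h]
  have hd : G.degree x = 3 := by
    rw [← G.card_neighborFinset_eq_degree, G.neighborFinset_eq_filter, hN,
      Finset.card_eq_three]
    exact ⟨a, b, c, hab, hac, hbc, rfl⟩
  unfold laplacian
  rw [← Finset.sum_filter]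
  rw [show (Finset.univ.filter fun v => G.Adj x v) = {a, b, c} by convert hN,
    Finset.sum_insert (by simp [hab, hac]), Finset.sum_pair hbc]
  congr 1
  · ring
  · convert congrArg (Nat.cast (R := ℝ)) hd
    norm_num

end Curvature

/-! ### First-return maps of cyclic permutations -/

/-- Under a permutation `F` with a single cycle, the elements of a nonempty set `S` are visited
in a cyclic order; `y` lists them in this order, as a sequence with period `|S|`. -/
theorem exists_cyclic_enumeration {D : Type*} [Finite D] (F : Equiv.Perm D)
    (hF : ∀ d e, F.SameCycle d e) {S : Set D} (hS : S.Nonempty) :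
    ∃ y : ℤ → D, (∀ d, d ∈ S ↔ ∃ i, y i = d) ∧
      (∀ i j, y i = y j ↔ (S.ncard : ℤ) ∣ i - j) ∧
      ∀ i, ∃ k, 0 < k ∧ (F ^ k) (y i) = y (i + 1) ∧ ∀ j, 0 < j → j < k → (F ^ j) (y i) ∉ S := by
  classical
  have hpow : ∀ d e, ∃ n, 0 < n ∧ (F ^ n) d = e := fun d e => by
    obtain ⟨n, hn, -, h⟩ := (hF d e).exists_pow_eq''
    exact ⟨n, hn, h⟩
  have hret : ∀ d : S, ∃ n, 0 < n ∧ (F ^ n) d.1 ∈ S := fun d => by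
    obtain ⟨n, hn, h⟩ := hpow d d
    exact ⟨n, hn, by rw [h]; exact d.2⟩
  let r : S → S := fun d => ⟨(F ^ Nat.find (hret d)) d.1, (Nat.find_spec (hret d)).2⟩
  have htrans : ∀ n, ∀ d e : S, (F ^ n) d.1 = e.1 → ∃ m, r^[m] d = e := by
    intro n
    induction n using Nat.strong_induction_on with
    | _ n ih =>
      intro d e h
      rcases Nat.eq_zero_or_pos n with rfl | hn
      · exact ⟨0, Subtype.ext (by simpa using h)⟩
      · have hle : Nat.find (hret d) ≤ n := Nat.find_min' _ ⟨hn, by rw [h]; exact e.2⟩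
        obtain ⟨m, hm⟩ := ih (n - Nat.find (hret d))
          (by have := (Nat.find_spec (hret d)).1; omega) (r d) e (by
            show (F ^ (n - Nat.find (hret d))) ((F ^ Nat.find (hret d)) d.1) = e.1
            rw [← Equiv.Perm.mul_apply, ← pow_add, Nat.sub_add_cancel hle, h])
        exact ⟨m + 1, by rw [Function.iterate_succ_apply, hm]⟩
  have htrans' : ∀ d e : S, ∃ m, r^[m] d = e := fun d e => by
    obtain ⟨n, -, h⟩ := hpow d.1 e.1
    exact htrans n d e h
  have hsurj : Function.Surjective r := fun e => by
    obtain ⟨m, hm⟩ := htrans' (r e) e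
    refine ⟨r^[m] e, ?_⟩
    rw [← Function.iterate_succ_apply' r, Function.iterate_succ_apply, hm]
  let σ : Equiv.Perm S :=
    Equiv.ofBijective r (Finite.injective_iff_surjective.2 hsurj).bijective_of_finite
  have hσpow : ∀ (m : ℕ) d, (σ ^ m) d = r^[m] d := fun m d => by
    rw [Equiv.Perm.coe_pow]; rfl
  let _ : Fintype S := Fintype.ofFinite S
  have hcyc : σ.IsCycleOn ((Finset.univ : Finset S) : Set S) := by
    rw [Finset.coe_univ]
    refine ⟨Set.bijOn_univ.2 σ.bijective, fun d _ e _ => ?_⟩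
    obtain ⟨m, hm⟩ := htrans' d e
    exact ⟨m, by rw [zpow_natCast, hσpow, hm]⟩
  obtain ⟨a, ha⟩ := hS
  refine ⟨fun i => ((σ ^ i) ⟨a, ha⟩).1, fun d => ⟨fun hd => ?_, ?_⟩, fun i j => ?_, fun i => ?_⟩
  · obtain ⟨m, hm⟩ := htrans' ⟨a, ha⟩ ⟨d, hd⟩
    exact ⟨m, by simp only [zpow_natCast, hσpow, hm]⟩
  · rintro ⟨i, rfl⟩
    exact Subtype.coe_prop _
  · rw [← Subtype.ext_iff, hcyc.zpow_apply_eq_zpow_apply (Finset.mem_univ _), Finset.card_univ,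
      ← Nat.card_eq_fintype_card, Nat.card_coe_set_eq, Int.modEq_comm, Int.modEq_iff_dvd]
  · have hs := Nat.find_spec (hret ((σ ^ i) ⟨a, ha⟩))
    refine ⟨Nat.find (hret ((σ ^ i) ⟨a, ha⟩)), hs.1, ?_, fun j hj hlt hmem => ?_⟩
    · beta_reduce
      rw [add_comm i, zpow_add, zpow_one, Equiv.Perm.mul_apply]
      rfl
    · exact Nat.find_min _ hlt ⟨hj, hmem⟩

/-! ### The leaves of an embedded tree -/

section Leaves

variable {V : Type*}

theorem forall_of_connected {T : SimpleGraph V} (hT : T.Connected) {Q : V → Prop} {a : V}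
    (ha : Q a) (h : ∀ u v, T.Adj u v → Q u → Q v) (v : V) : Q v := by
  obtain ⟨p⟩ := hT a v
  induction p with
  | nil => exact ha
  | cons hadj p ih => exact ih (h _ _ hadj ha)

variable {T : SimpleGraph V}

namespace RotationSystem

variable (ρ : RotationSystem T)

theorem rot_fst (d : T.Dart) : (ρ.rot d).fst = d.fst :=
  (ρ.sameCycle_iff _ _).1 (Equiv.Perm.sameCycle_apply_left.2 (Equiv.Perm.SameCycle.refl _ _))

theorem faceStep_apply (d : T.Dart) : ρ.faceStep d = ρ.rot d.symm := rfl

theorem faceStep_fst (d : T.Dart) : (ρ.faceStep d).fst = d.snd :=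
  ρ.rot_fst _

/-- The rotation at a vertex returns to its starting point only after all neighbours have been
passed. -/
theorem rot_pow_ne [Fintype V] (d : T.Dart) {k : ℕ} (hk : 0 < k)
    (hd : k < (T.neighborSet d.fst).ncard) : (ρ.rot ^ k) d ≠ d := by
  classical
  intro h
  have hsub : T.neighborSet d.fst ⊆
      (fun j => ((ρ.rot ^ j) d).snd) '' (Finset.range k : Set ℕ) := by
    intro v hv
    obtain ⟨n, hn⟩ := ((ρ.sameCycle_iff d ⟨(d.fst, v), hv⟩).2 rfl).exists_nat_pow_eq
    refine ⟨n % k, by simpa using Nat.mod_lt _ hk, ?_⟩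
    have : (ρ.rot ^ n) d = (ρ.rot ^ (n % k)) d := by
      conv_lhs => rw [← Nat.mod_add_div n k, pow_add, pow_mul, Equiv.Perm.mul_apply]
      rw [Equiv.Perm.pow_apply_eq_self_of_apply_eq_self h]
    rw [this] at hn
    simp [hn]
  have h1 := Set.ncard_le_ncard hsub (Set.toFinite _)
  have h2 := Set.ncard_image_le (f := fun j => ((ρ.rot ^ j) d).snd)
    (Finset.range k).finite_toSet
  rw [Set.ncard_coe_finset, Finset.card_range] at h2
  omega

/-- An embedding of a tree in the sphere has a single face. -/
theorem IsPlanar.sameCycle [Finite V] {ρ : RotationSystem T} (hρ : ρ.IsPlanar) (hT : T.IsTree)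
    (d e : T.Dart) : ρ.faceStep.SameCycle d e := by
  have h1 := (SimpleGraph.isTree_iff_connected_and_card.1 hT).2
  have h2 : Nat.card ρ.Face = 1 := by
    unfold IsPlanar at hρ
    rw [Nat.card_coe_set_eq] at h1
    omega
  have h3 := (Nat.card_eq_one_iff_unique.1 h2).1
  exact Quotient.exact (s := Equiv.Perm.SameCycle.setoid ρ.faceStep)
    (h3.elim (Quotient.mk _ d) (Quotient.mk _ e))

end RotationSystem

theorem isLeaf_iff_existsUnique [Fintype V] {v : V} : IsLeaf T v ↔ ∃! w, T.Adj v w := by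
  classical
  unfold IsLeaf
  exact SimpleGraph.degree_eq_one_iff_existsUnique_adj

theorem IsLeaf.eq_of_adj [Fintype V] {v u w : V} (hv : IsLeaf T v) (hu : T.Adj v u)
    (hw : T.Adj v w) : u = w :=
  (isLeaf_iff_existsUnique.1 hv).unique hu hw

theorem IsLeaf.dart_eq [Fintype V] {d e : T.Dart} (hd : IsLeaf T d.fst) (h : d.fst = e.fst) :
    d = e := by
  rcases d with ⟨⟨a, b⟩, hab⟩
  rcases e with ⟨⟨a', c⟩, hac⟩
  obtain rfl : a = a' := h
  obtain rfl : b = c := IsLeaf.eq_of_adj hd hab hac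
  rfl

/-- The leaves of the embedded tree in the cyclic order in which they lie around it.

The last two conditions make the order precise: consecutive leaves are exactly those related by
`NextLeaf`, and if the neighbour `x i` of an inner vertex `p` is followed by a leaf in the rotation
at `p`, then this leaf is `x (i + 1)`. -/
theorem RotationSystem.IsPlanar.exists_leaf_enumeration [Fintype V] {ρ : RotationSystem T}
    (hρ : ρ.IsPlanar) (hT : T.IsTree) (hleaf : ∃ v, IsLeaf T v) :
    ∃ x : ℤ → V, (∀ v, IsLeaf T v ↔ ∃ i, x i = v) ∧
      (∀ i j, x i = x j ↔ ({v | IsLeaf T v}.ncard : ℤ) ∣ i - j) ∧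
      (∀ a b, NextLeaf ρ a b ↔ ∃ i, a = x i ∧ b = x (i + 1)) ∧
      ∀ (i : ℤ) (d : T.Dart), ¬ IsLeaf T d.fst → d.snd = x i → IsLeaf T (ρ.rot d).snd →
        x (i + 1) = (ρ.rot d).snd := by
  classical
  set S : Set T.Dart := {d | IsLeaf T d.fst} with hS
  have hinj : Set.InjOn (fun d : T.Dart => d.fst) S := fun d hd e _ h => IsLeaf.dart_eq hd h
  have himg : (fun d : T.Dart => d.fst) '' S = {v | IsLeaf T v} := by
    ext v
    refine ⟨?_, fun hv => ?_⟩
    · rintro ⟨d, hd, rfl⟩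
      exact hd
    · obtain ⟨w, hw, -⟩ := isLeaf_iff_existsUnique.1 hv
      exact ⟨⟨(v, w), hw⟩, hv, rfl⟩
  have hcard : S.ncard = {v | IsLeaf T v}.ncard := by rw [← himg, hinj.ncard_image]
  have hne : S.Nonempty := by
    rw [← Set.image_nonempty, himg]
    exact hleaf
  obtain ⟨y, hy1, hy2, hy3⟩ :=
    exists_cyclic_enumeration ρ.faceStep (hρ.sameCycle hT) hne
  have hyS : ∀ i, y i ∈ S := fun i => (hy1 _).2 ⟨i, rfl⟩
  refine ⟨fun i => (y i).fst, fun v => ?_, fun i j => ?_, fun a b => ⟨?_, ?_⟩,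
    fun i d hd hdi hl => ?_⟩
  · change v ∈ {v | IsLeaf T v} ↔ _
    rw [← himg]
    constructor
    · rintro ⟨d, hd, rfl⟩
      obtain ⟨i, rfl⟩ := (hy1 d).1 hd
      exact ⟨i, rfl⟩
    · rintro ⟨i, rfl⟩
      exact ⟨y i, hyS i, rfl⟩
  · rw [← hcard, ← hy2]
    exact ⟨fun h => hinj (hyS i) (hyS j) h, fun h => congrArg (fun d : T.Dart => d.fst) h⟩
  · rintro ⟨ha, hb, d, k, rfl, hk, rfl, hmin⟩
    obtain ⟨i, rfl⟩ := (hy1 d).1 ha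
    refine ⟨i, rfl, ?_⟩
    obtain ⟨k', hk', h', hmin'⟩ := hy3 i
    obtain rfl : k = k' := by
      rcases lt_trichotomy k k' with h | h | h
      · exact absurd hb (hmin' k hk h)
      · exact h
      · exact absurd (h' ▸ hyS (i + 1)) (hmin k' hk' h)
    rw [h']
  · rintro ⟨i, rfl, rfl⟩
    obtain ⟨k, hk, h, hmin⟩ := hy3 i
    exact ⟨hyS i, hyS (i + 1), y i, k, rfl, hk, by rw [h], hmin⟩
  · have hd1 : d.symm = y i := by
      have hleaf : IsLeaf T d.snd := by
        rw [hdi]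
        exact hyS i
      exact IsLeaf.dart_eq (d := d.symm) hleaf hdi
    have h1 : ρ.faceStep (y i) = ρ.rot d := by
      rw [← hd1, RotationSystem.faceStep_apply, SimpleGraph.Dart.symm_symm]
    have h2 : ((ρ.faceStep ^ 2) (y i)).fst = (ρ.rot d).snd := by
      rw [pow_two, Equiv.Perm.mul_apply, RotationSystem.faceStep_fst, h1]
    -- The face walk from `x i` visits the inner vertex `d.fst` and then the leaf, after two steps.
    obtain ⟨k, hk, h, hmin⟩ := hy3 i
    obtain rfl : k = 2 := by
      by_contra hk2
      rcases (show k = 1 ∨ 2 < k by omega) with rfl | hlt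
      · rw [pow_one, h1] at h
        have := hyS (i + 1)
        rw [← h] at this
        exact hd (ρ.rot_fst d ▸ this)
      · refine hmin 2 two_pos hlt ?_
        show IsLeaf T _
        rw [h2]
        exact hl
    rw [← h2, h]

end Leaves

/-! ### Halin graphs as trees with a cyclic enumeration of the leaves -/

section Presentation

variable {V : Type*} [Fintype V] {T G : SimpleGraph V}

theorem degree_eq_ncard {V : Type*} (G : SimpleGraph V) (v : V) [Fintype (G.neighborSet v)] :
    G.degree v = (G.neighborSet v).ncard := by
  rw [← SimpleGraph.card_neighborSet_eq_degree, ← Nat.card_eq_fintype_card, Nat.card_coe_set_eq]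

/-- The number of leaves of `T`. -/
noncomputable def leafCount (T : SimpleGraph V) : ℕ := {v | IsLeaf T v}.ncard

/-- Counting edges: a tree whose inner vertices have degree at least three has at least two more
leaves than inner vertices. -/
theorem ncard_inner_add_two_le (hT : T.IsTree)
    (hdeg : ∀ v, ¬ IsLeaf T v → 3 ≤ (T.neighborSet v).ncard) :
    {v | ¬ IsLeaf T v}.ncard + 2 ≤ leafCount T := by
  classical
  have h1 := T.sum_degrees_eq_twice_card_edges
  have h2 := hT.card_edgeFinset
  have h3 : ∀ v, 3 ≤ T.degree v + 2 * (if IsLeaf T v then 1 else 0) := by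
    intro v
    by_cases hv : IsLeaf T v
    · have : T.degree v = 1 := by
        unfold IsLeaf at hv
        convert hv
      simp [hv, this]
    · simpa [hv, degree_eq_ncard] using hdeg v hv
  have h4 := Finset.sum_le_sum fun v (_ : v ∈ Finset.univ) => h3 v
  rw [Finset.sum_add_distrib, ← Finset.mul_sum, Finset.sum_boole, h1, Finset.sum_const,
    Finset.card_univ, smul_eq_mul] at h4
  have h5 : leafCount T = (Finset.univ.filter fun v => IsLeaf T v).card := by
    rw [leafCount, ← Set.ncard_coe_finset]
    simp
  have h6 : {v | ¬ IsLeaf T v}.ncard + leafCount T = Fintype.card V := by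
    rw [leafCount, ← Nat.card_eq_fintype_card, ← Set.ncard_add_ncard_compl {v | ¬ IsLeaf T v}]
    congr 2
    ext v
    simp
  rw [← h5] at h4
  simp only [Nat.cast_id] at h4
  omega

/-- `G` is the Halin graph of the tree `T`, where `x` lists the leaves of `T` in their cyclic order
around the embedded tree, as a sequence with period the number of leaves. The embedding of `T` is
remembered only by this order and by the field `fan`: if `q` is the only inner neighbour of the
inner vertex `p`, then the leaves at `p`, of which there are at least two, follow each other in the
cyclic order, from `x i` to `e`. -/
structure HalinPresentation (T G : SimpleGraph V) (x : ℤ → V) : Prop where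
  isTree : T.IsTree
  isLeaf_iff : ∀ v, IsLeaf T v ↔ ∃ i, x i = v
  eq_iff : ∀ i j, x i = x j ↔ (leafCount T : ℤ) ∣ i - j
  adj_iff : ∀ u v, G.Adj u v ↔
    T.Adj u v ∨ ∃ i, (u = x i ∧ v = x (i + 1)) ∨ (u = x (i + 1) ∧ v = x i)
  exists_inner : ∃ v, ¬ IsLeaf T v
  inner_degree : ∀ v, ¬ IsLeaf T v → 3 ≤ (T.neighborSet v).ncard
  inner_of_adj : ∀ i v, T.Adj (x i) v → ¬ IsLeaf T v
  fan : ∀ p q, ¬ IsLeaf T p → ¬ IsLeaf T q → T.Adj p q →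
    (∀ r, T.Adj p r → r ≠ q → IsLeaf T r) → ∃ i e, T.Adj (x i) p ∧ T.Adj (x (i + 1)) p ∧
      ∀ j, T.Adj (x j) p → x j ≠ e → T.Adj (x (j + 1)) p ∧ x (j + 1) ≠ x i

theorem RotationSystem.exists_fan {ρ : RotationSystem T} {x : ℤ → V}
    (hx1 : ∀ v, IsLeaf T v ↔ ∃ i, x i = v)
    (hx2 : ∀ (i : ℤ) (d : T.Dart), ¬ IsLeaf T d.fst → d.snd = x i → IsLeaf T (ρ.rot d).snd →
      x (i + 1) = (ρ.rot d).snd)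
    {p q : V} (hp : ¬ IsLeaf T p) (hq : ¬ IsLeaf T q) (hpq : T.Adj p q)
    (hall : ∀ r, T.Adj p r → r ≠ q → IsLeaf T r) (hdeg : 3 ≤ (T.neighborSet p).ncard) :
    ∃ i e, T.Adj (x i) p ∧ T.Adj (x (i + 1)) p ∧
      ∀ j, T.Adj (x j) p → x j ≠ e → T.Adj (x (j + 1)) p ∧ x (j + 1) ≠ x i := by
  let e₀ : T.Dart := ⟨(p, q), hpq⟩
  have hfst : ∀ k : ℕ, ((ρ.rot ^ k) e₀).fst = p := fun k =>
    ((ρ.sameCycle_iff e₀ _).1 ⟨k, by rw [zpow_natCast]⟩).symm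
  have hadj : ∀ k : ℕ, T.Adj ((ρ.rot ^ k) e₀).snd p := fun k => by
    have := ((ρ.rot ^ k) e₀).adj
    rw [hfst] at this
    exact this.symm
  have hleaf : ∀ d : T.Dart, d.fst = p → d ≠ e₀ → IsLeaf T d.snd := by
    rintro ⟨⟨a, b⟩, hab⟩ (rfl : a = p) hne
    refine hall b hab fun hb => hne ?_
    subst hb
    rfl
  have hleafk : ∀ k : ℕ, 0 < k → k < (T.neighborSet p).ncard →
      IsLeaf T ((ρ.rot ^ k) e₀).snd := fun k hk hkd =>
    hleaf _ (hfst k) (ρ.rot_pow_ne e₀ hk hkd)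
  have hnext : ∀ (i : ℤ) (k : ℕ), x i = ((ρ.rot ^ k) e₀).snd → k + 1 < (T.neighborSet p).ncard →
      x (i + 1) = ((ρ.rot ^ (k + 1)) e₀).snd := by
    intro i k hi hk
    have h := hleafk (k + 1) k.succ_pos hk
    rw [pow_succ', Equiv.Perm.mul_apply] at h ⊢
    exact hx2 i _ (by rw [hfst]; exact hp) hi.symm h
  obtain ⟨i, hi⟩ := (hx1 _).1 (hleafk 1 one_pos (by omega))
  have hi1 := hnext i 1 hi (by omega)
  refine ⟨i, (ρ.rot⁻¹ e₀).snd, by rw [hi]; exact hadj 1, by rw [hi1]; exact hadj 2,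
    fun j hj hje => ?_⟩
  · let d : T.Dart := ⟨(p, x j), hj.symm⟩
    have hd : ρ.rot d ≠ e₀ := fun h => hje (by rw [← h]; simp [d])
    have h := hleaf (ρ.rot d) (ρ.rot_fst d) hd
    rw [hx2 j d hp rfl h]
    refine ⟨?_, fun h' => hq ?_⟩
    · have := (ρ.rot d).adj
      rw [ρ.rot_fst] at this
      exact this.symm
    · rw [hi, pow_one] at h'
      have h1 : ρ.rot d = ρ.rot e₀ :=
        SimpleGraph.Dart.ext _ _ (Prod.ext ((ρ.rot_fst d).trans (ρ.rot_fst e₀).symm) h')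
      have h2 : x j = q := congrArg (fun d : T.Dart => d.snd) (ρ.rot.injective h1)
      exact (hx1 q).2 ⟨j, h2⟩

theorem IsHalin.exists_presentation (hG : IsHalin G) :
    ∃ (T : SimpleGraph V) (x : ℤ → V), HalinPresentation T G x := by
  classical
  obtain ⟨⟨T, hT, hmax, ρ, hρ, hGT⟩, hdeg2⟩ := hG
  have : Nonempty V := hT.connected.nonempty
  obtain ⟨v₀, hv₀⟩ := T.exists_maximal_degree_vertex
  have hv₀3 : 3 ≤ T.degree v₀ := by
    rw [← hv₀]
    convert hmax
  have hv₀inner : ¬ IsLeaf T v₀ := fun h => by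
    have : T.degree v₀ = 1 := by
      unfold IsLeaf at h
      convert h
    omega
  obtain ⟨w₀, hw₀⟩ := (T.degree_pos_iff_exists_adj v₀).1 (by omega)
  have : Nontrivial V := ⟨v₀, w₀, hw₀.ne⟩
  have hleaf : ∃ v, IsLeaf T v := by
    obtain ⟨v, hv⟩ := hT.exists_vert_degree_one_of_nontrivial
    refine ⟨v, ?_⟩
    unfold IsLeaf
    convert hv
  obtain ⟨x, hx1, hx2, hx3, hx4⟩ := hρ.exists_leaf_enumeration hT hleaf
  have hinner : ∀ u v, IsLeaf T u → T.Adj u v → ¬ IsLeaf T v := by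
    intro u v hu huv hv
    refine hv₀inner ?_
    have : v₀ = u ∨ v₀ = v := by
      refine forall_of_connected hT.connected (Q := fun w => w = u ∨ w = v) (Or.inl rfl) ?_ v₀
      rintro a b hab (rfl | rfl)
      · exact Or.inr (hu.eq_of_adj hab huv)
      · exact Or.inl (hv.eq_of_adj hab huv.symm)
    rcases this with rfl | rfl
    · exact hu
    · exact hv
  have hdeg : ∀ v, ¬ IsLeaf T v → 3 ≤ (T.neighborSet v).ncard := by
    intro v hv
    have hG : G.neighborSet v = T.neighborSet v := by
      ext w
      rw [SimpleGraph.mem_neighborSet, SimpleGraph.mem_neighborSet, hGT, SimpleGraph.sup_adj,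
        leafCycle, SimpleGraph.fromRel_adj]
      exact ⟨fun h => h.resolve_right fun h' => h'.2.elim (fun h => hv h.1) (fun h => hv h.2.1),
        Or.inl⟩
    have h2 : (T.neighborSet v).ncard ≠ 2 := by
      rw [← hG, ← degree_eq_ncard]
      convert hdeg2 v
    have h1 : (T.neighborSet v).ncard ≠ 1 := fun h => by
      rw [← degree_eq_ncard] at h
      refine hv ?_
      unfold IsLeaf
      convert h
    have h0 : 0 < T.degree v := hT.connected.preconnected.degree_pos_of_nontrivial v
    rw [degree_eq_ncard] at h0
    omega
  have hcount := ncard_inner_add_two_le hT hdeg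
  have hsucc : ∀ i, x i ≠ x (i + 1) := by
    intro i h
    have h1 := (hx2 _ _).1 h
    rw [show i - (i + 1) = -1 by ring, dvd_neg] at h1
    have h2 := Int.le_of_dvd one_pos h1
    unfold leafCount at hcount
    omega
  have hadj : ∀ u v, G.Adj u v ↔
      T.Adj u v ∨ ∃ i, (u = x i ∧ v = x (i + 1)) ∨ (u = x (i + 1) ∧ v = x i) := by
    intro u v
    rw [hGT, SimpleGraph.sup_adj, leafCycle, SimpleGraph.fromRel_adj, hx3, hx3]
    refine or_congr_right ⟨?_, ?_⟩
    · rintro ⟨-, ⟨i, h⟩ | ⟨i, h⟩⟩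
      · exact ⟨i, Or.inl h⟩
      · exact ⟨i, Or.inr h.symm⟩
    · rintro ⟨i, ⟨rfl, rfl⟩ | ⟨rfl, rfl⟩⟩
      · exact ⟨hsucc i, Or.inl ⟨i, rfl, rfl⟩⟩
      · exact ⟨(hsucc i).symm, Or.inr ⟨i, rfl, rfl⟩⟩
  exact ⟨T, x, hT, hx1, hx2, hadj, ⟨v₀, hv₀inner⟩, hdeg,
    fun i v h => hinner _ _ ((hx1 _).2 ⟨i, rfl⟩) h,
    fun p q hp hq hpq hall => RotationSystem.exists_fan hx1 hx4 hp hq hpq hall (hdeg p hp)⟩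

end Presentation

namespace HalinPresentation

variable {V : Type*} [Fintype V] {T G : SimpleGraph V} {x : ℤ → V}

theorem three_le_leafCount (h : HalinPresentation T G x) : 3 ≤ leafCount T := by
  have h1 := ncard_inner_add_two_le h.isTree h.inner_degree
  have h2 : 0 < {v | ¬ IsLeaf T v}.ncard := (Set.ncard_pos (Set.toFinite _)).2 h.exists_inner
  omega

theorem connected (h : HalinPresentation T G x) : G.Connected :=
  h.isTree.connected.mono fun _ _ huv => (h.adj_iff _ _).2 (Or.inl huv)

theorem isLeaf (h : HalinPresentation T G x) (i : ℤ) : IsLeaf T (x i) :=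
  (h.isLeaf_iff _).2 ⟨i, rfl⟩

theorem inner_ne (h : HalinPresentation T G x) {p : V} (hp : ¬ IsLeaf T p) (i : ℤ) : p ≠ x i :=
  fun hi => hp (hi ▸ h.isLeaf i)

theorem ne_of_lt (h : HalinPresentation T G x) {i j : ℤ} (h1 : i < j) (h2 : j < i + leafCount T) :
    x i ≠ x j := by
  intro hij
  have h3 := Int.le_of_dvd (by omega) ((h.eq_iff j i).1 hij.symm)
  omega

theorem exists_parent (h : HalinPresentation T G x) (i : ℤ) : ∃ p, T.Adj (x i) p :=
  (isLeaf_iff_existsUnique.1 (h.isLeaf i)).exists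

theorem parent_eq (h : HalinPresentation T G x) {i : ℤ} {p q : V} (hp : T.Adj (x i) p)
    (hq : T.Adj (x i) q) : p = q :=
  (h.isLeaf i).eq_of_adj hp hq

theorem adj_leaf_iff (h : HalinPresentation T G x) {i : ℤ} {p : V} (hp : T.Adj (x i) p) (v : V) :
    G.Adj (x i) v ↔ v = p ∨ v = x (i - 1) ∨ v = x (i + 1) := by
  rw [h.adj_iff]
  constructor
  · rintro (hv | ⟨j, ⟨hj, rfl⟩ | ⟨hj, rfl⟩⟩)
    · exact Or.inl (h.parent_eq hv hp)
    · refine Or.inr (Or.inr ((h.eq_iff _ _).2 ?_))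
      rw [show j + 1 - (i + 1) = -(i - j) by ring, dvd_neg]
      exact (h.eq_iff _ _).1 hj
    · refine Or.inr (Or.inl ((h.eq_iff _ _).2 ?_))
      rw [show j - (i - 1) = -(i - (j + 1)) by ring, dvd_neg]
      exact (h.eq_iff _ _).1 hj
  · rintro (rfl | rfl | rfl)
    · exact Or.inl hp
    · exact Or.inr ⟨i - 1, Or.inr ⟨by rw [sub_add_cancel], rfl⟩⟩
    · exact Or.inr ⟨i, Or.inl ⟨rfl, rfl⟩⟩

theorem adj_inner_iff (h : HalinPresentation T G x) {p : V} (hp : ¬ IsLeaf T p) (v : V) :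
    G.Adj p v ↔ T.Adj p v := by
  rw [h.adj_iff]
  refine or_iff_left ?_
  rintro ⟨i, ⟨rfl, -⟩ | ⟨rfl, -⟩⟩
  · exact hp (h.isLeaf _)
  · exact hp (h.isLeaf _)

/-- Any `|L|` consecutive members of the sequence exhaust the leaves. -/
theorem exists_lt_eq (h : HalinPresentation T G x) (i k : ℤ) :
    ∃ m : ℕ, m < leafCount T ∧ x k = x (i + m) := by
  have hL : (0 : ℤ) < leafCount T := by have := h.three_le_leafCount; omega
  have h0 := Int.emod_nonneg (k - i) hL.ne'
  have h1 := Int.emod_lt_of_pos (k - i) hL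
  refine ⟨((k - i) % leafCount T).toNat, by omega, (h.eq_iff _ _).2 ?_⟩
  rw [Int.toNat_of_nonneg h0, ← sub_sub]
  exact Int.dvd_self_sub_emod

theorem forall_of_step (h : HalinPresentation T G x) {Q : V → Prop} {i : ℤ} (h0 : Q (x i))
    (hstep : ∀ j, Q (x j) → Q (x (j + 1))) (k : ℤ) : Q (x k) := by
  have hall : ∀ m : ℕ, Q (x (i + m)) := by
    intro m
    induction m with
    | zero => simpa using h0
    | succ m ih => simpa [add_assoc] using hstep _ ih
  obtain ⟨m, -, hm⟩ := h.exists_lt_eq i k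
  rw [hm]
  exact hall m

theorem laplacian_leaf (h : HalinPresentation T G x) {i : ℤ} {p : V} (hp : T.Adj (x i) p)
    (f : V → ℝ) :
    laplacian G f (x i) = (f p + f (x (i - 1)) + f (x (i + 1)) - 3 * f (x i)) / 3 := by
  have hL := h.three_le_leafCount
  have hpi := h.inner_of_adj i p hp
  exact laplacian_of_three (h.inner_ne hpi _) (h.inner_ne hpi _)
    (h.ne_of_lt (by omega) (by omega)) (h.adj_leaf_iff hp) f

/-! ### The curvature of the edges of the leaf cycle -/

/-- At an end of a fan of leaves at `p`, the edge of the leaf cycle leaving the fan has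
nonpositive curvature as soon as the cycle has length at least six. -/
theorem leafCount_le_five (h : HalinPresentation T G x) (hpos : HasPositiveLLYCurvature G)
    {i : ℤ} {p : V} (h0 : T.Adj (x i) p) (h1 : T.Adj (x (i + 1)) p)
    (h2 : ¬ T.Adj (x (i - 1)) p) (h3 : ¬ T.Adj (x (i - 2)) p) : leafCount T ≤ 5 := by
  classical
  by_contra! hL
  obtain ⟨r, hr⟩ := h.exists_parent (i - 1)
  obtain ⟨s, hs⟩ := h.exists_parent (i - 2)
  have hp := h.inner_of_adj _ _ h0
  have hri := h.inner_of_adj _ _ hr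
  have hsi := h.inner_of_adj _ _ hs
  have hadj := h.adj_leaf_iff hs
  rw [show i - 2 - 1 = i - 3 by ring, show i - 2 + 1 = i - 1 by ring] at hadj
  have hpr : p ≠ r := by rintro rfl; exact h2 hr
  have hps : p ≠ s := by rintro rfl; exact h3 hs
  -- The two exceptional vertices `x (i + 1)` and `x (i - 2)` have distance three, because the cycle
  -- is long; this is what makes `f` Lipschitz.
  let f : V → ℝ := fun v => if v = x (i + 1) then -1 else if v = x (i - 2) then 2
    else if G.Adj (x (i - 2)) v ∨ v = r then 1 else 0
  have hf_le : ∀ v, v ≠ x (i - 2) → f v ≤ 1 := fun v hv => by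
    simp only [f, hv, if_false]
    split_ifs <;> norm_num
  have hf_ge : ∀ v, v ≠ x (i + 1) → 0 ≤ f v := fun v hv => by
    simp only [f, hv, if_false]
    split_ifs <;> norm_num
  have hf_zero : ∀ v, v = p ∨ v = x i ∨ v = x (i + 2) → f v = 0 := by
    have e1 := h.ne_of_lt (i := i) (j := i + 1) (by omega) (by omega)
    have e2 := h.ne_of_lt (i := i - 2) (j := i) (by omega) (by omega)
    have e3 := h.ne_of_lt (i := i - 3) (j := i) (by omega) (by omega)
    have e4 := h.ne_of_lt (i := i - 1) (j := i) (by omega) (by omega)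
    have e5 := h.ne_of_lt (i := i + 1) (j := i + 2) (by omega) (by omega)
    have e6 := h.ne_of_lt (i := i - 2) (j := i + 2) (by omega) (by omega)
    have e7 := h.ne_of_lt (i := i - 3) (j := i + 2) (by omega) (by omega)
    have e8 := h.ne_of_lt (i := i - 1) (j := i + 2) (by omega) (by omega)
    rintro v (rfl | rfl | rfl)
    · simp [f, hadj, h.inner_ne hp, hps, hpr]
    · simp [f, hadj, e1, e2.symm, e3.symm, e4.symm, (h.inner_ne hsi _).symm,
        (h.inner_ne hri _).symm]
    · simp [f, hadj, e5.symm, e6.symm, e7.symm, e8.symm, (h.inner_ne hsi _).symm,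
        (h.inner_ne hri _).symm]
  have hf_neg : f (x (i + 1)) = -1 := by simp [f]
  have hf_two : f (x (i - 2)) = 2 := by
    simp [f, h.ne_of_lt (i := i - 2) (j := i + 1) (by omega) (by omega)]
  have hf_one : ∀ v, v ≠ x (i + 1) → G.Adj (x (i - 2)) v ∨ v = r → v ≠ x (i - 2) → f v = 1 := by
    intro v e1 e2 e3
    simp only [f, e1, e2, e3, if_true, if_false]
  have hnadj : ¬ G.Adj (x (i - 2)) (x (i + 1)) := by
    rw [hadj]
    rintro (e | e | e)
    · exact h.inner_ne hsi _ e.symm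
    · exact h.ne_of_lt (by omega) (by omega) e.symm
    · exact h.ne_of_lt (by omega) (by omega) e.symm
  have hlip : ∀ u v, G.Adj u v → f v - f u ≤ 1 := by
    intro u v huv
    by_cases hu : u = x (i + 1)
    · subst hu
      rw [hf_neg, hf_zero v]
      · norm_num
      · have := (h.adj_leaf_iff h1 v).1 huv
        rwa [show i + 1 - 1 = i by ring, show i + 1 + 1 = i + 2 by ring] at this
    · by_cases hv : v = x (i - 2)
      · subst hv
        rw [hf_two, hf_one u hu (Or.inl huv.symm) huv.ne]
        norm_num
      · linarith [hf_le v hv, hf_ge u hu]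
  have hy : f (x (i - 1)) = 1 := hf_one _ (h.ne_of_lt (by omega) (by omega))
    (Or.inl ((hadj _).2 (Or.inr (Or.inr rfl)))) (h.ne_of_lt (by omega) (by omega)).symm
  have hxy : G.Adj (x i) (x (i - 1)) := (h.adj_leaf_iff h0 _).2 (Or.inr (Or.inl rfl))
  have key := hpos.laplacian_lt h.connected hxy hlip
    (by rw [hy, hf_zero _ (Or.inr (Or.inl rfl))]; norm_num)
  rw [h.laplacian_leaf h0, h.laplacian_leaf hr, show i - 1 - 1 = i - 2 by ring,
    sub_add_cancel, hy, hf_two, hf_neg, hf_zero p (Or.inl rfl), hf_zero _ (Or.inr (Or.inl rfl)),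
    hf_one r (h.inner_ne hri _) (Or.inr rfl) (h.inner_ne hri _)] at key
  norm_num at key

/-- If the leaf cycle is not a quadrangle, then the edge of the leaf cycle leaving a fan at `p` has
nonpositive curvature unless it ends at a leaf whose neighbour `r` is adjacent to `p`. -/
theorem adj_of_fan (h : HalinPresentation T G x) (hpos : HasPositiveLLYCurvature G)
    (hL : 5 ≤ leafCount T) {i : ℤ} {p r : V} (h0 : T.Adj (x i) p) (h1 : T.Adj (x (i + 1)) p)
    (h2 : ¬ T.Adj (x (i - 1)) p) (h3 : ¬ T.Adj (x (i - 2)) p) (hr : T.Adj (x (i - 1)) r) :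
    T.Adj p r := by
  classical
  by_contra hpr
  have hp := h.inner_of_adj _ _ h0
  have hri := h.inner_of_adj _ _ hr
  have hne : p ≠ r := by rintro rfl; exact h2 hr
  have e1 := h.ne_of_lt (i := i - 2) (j := i + 1) (by omega) (by omega)
  have e2 := h.ne_of_lt (i := i - 1) (j := i + 1) (by omega) (by omega)
  have e3 := h.ne_of_lt (i := i) (j := i + 1) (by omega) (by omega)
  have e4 := h.ne_of_lt (i := i - 2) (j := i) (by omega) (by omega)
  have e5 := h.ne_of_lt (i := i - 1) (j := i) (by omega) (by omega)
  have e6 := h.ne_of_lt (i := i - 2) (j := i + 2) (by omega) (by omega)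
  have e7 := h.ne_of_lt (i := i - 1) (j := i + 2) (by omega) (by omega)
  -- No edge joins `A` and `B`, so the difference of their indicators is Lipschitz.
  let A : V → Prop := fun v => v = p ∨ v = x (i + 1)
  let B : V → Prop := fun v => v = r ∨ v = x (i - 2) ∨ v = x (i - 1)
  have hAB : ∀ v, B v → ¬ A v := by
    rintro v (rfl | rfl | rfl) (e | e)
    · exact hne e.symm
    · exact h.inner_ne hri _ e
    · exact h.inner_ne hp _ e.symm
    · exact e1 e
    · exact h.inner_ne hp _ e.symm
    · exact e2 e
  have hsep : ∀ u v, A u → B v → ¬ G.Adj u v := by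
    rintro u v (rfl | rfl) hv huv
    · rw [h.adj_inner_iff hp] at huv
      rcases hv with rfl | rfl | rfl
      · exact hpr huv
      · exact h3 huv.symm
      · exact h2 huv.symm
    · rw [h.adj_leaf_iff h1, show i + 1 - 1 = i by ring, show i + 1 + 1 = i + 2 by ring] at huv
      rcases hv with rfl | rfl | rfl
      · exact huv.elim hne.symm fun h' => h'.elim (h.inner_ne hri _) (h.inner_ne hri _)
      · exact huv.elim (h.inner_ne hp _).symm fun h' => h'.elim e4 e6
      · exact huv.elim (h.inner_ne hp _).symm fun h' => h'.elim e5 e7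
  let f : V → ℝ := fun v => if A v then -1 else if B v then 1 else 0
  have hfA : ∀ v, A v → f v = -1 := fun v hv => by simp only [f, hv, if_true]
  have hfB : ∀ v, B v → f v = 1 := fun v hv => by simp only [f, hv, hAB v hv, if_true, if_false]
  have hf_le : ∀ v, ¬ B v → f v ≤ 0 := fun v hv => by
    simp only [f, hv, if_false]
    split_ifs <;> norm_num
  have hf_ge : ∀ v, ¬ A v → 0 ≤ f v := fun v hv => by
    simp only [f, hv, if_false]
    split_ifs <;> norm_num
  have hlip : ∀ u v, G.Adj u v → f v - f u ≤ 1 := by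
    intro u v huv
    by_cases hv : B v
    · have := hf_ge u fun hu => hsep u v hu hv huv
      linarith [hfB v hv]
    · have : -1 ≤ f u := by
        simp only [f]
        split_ifs <;> norm_num
      linarith [hf_le v hv]
  have hzero : f (x i) = 0 := by
    simp [f, A, B, (h.inner_ne hp _).symm, (h.inner_ne hri _).symm, e3, e4.symm, e5.symm]
  have hxy : G.Adj (x i) (x (i - 1)) := (h.adj_leaf_iff h0 _).2 (Or.inr (Or.inl rfl))
  have hy : f (x (i - 1)) = 1 := hfB _ (Or.inr (Or.inr rfl))
  have key := hpos.laplacian_lt h.connected hxy hlip (by rw [hzero, hy]; norm_num)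
  rw [h.laplacian_leaf h0, h.laplacian_leaf hr, show i - 1 - 1 = i - 2 by ring,
    sub_add_cancel, hy, hzero, hfA p (Or.inl rfl), hfA _ (Or.inr rfl), hfB r (Or.inl rfl),
    hfB (x (i - 2)) (Or.inr (Or.inl rfl))] at key
  norm_num at key

/-! ### Inner vertices with a single inner neighbour -/

/-- `p` is an inner vertex whose only inner neighbour is `q`: a leaf of the tree that remains
when the leaves of `T` are removed. -/
structure IsPendant (T : SimpleGraph V) (p q : V) : Prop where
  inner : ¬ IsLeaf T p
  inner' : ¬ IsLeaf T q
  adj : T.Adj p q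
  isLeaf_of_adj : ∀ r, T.Adj p r → r ≠ q → IsLeaf T r

theorem IsPendant.eq_of_adj {p q r : V} (hp : IsPendant T p q) (hr : T.Adj p r)
    (hri : ¬ IsLeaf T r) : r = q := by
  by_contra hne
  exact hri (hp.isLeaf_of_adj r hr hne)

theorem isTree_induce_inner (h : HalinPresentation T G x) :
    (T.induce {v | ¬ IsLeaf T v}).IsTree := by
  obtain ⟨a, ha⟩ := h.exists_inner
  have : Nonempty ({v | ¬ IsLeaf T v} : Set V) := ⟨⟨a, ha⟩⟩
  refine ⟨SimpleGraph.Connected.mk ?_, h.isTree.isAcyclic.induce _⟩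
  -- The statement is carried along a walk of `T`, a leaf standing for its neighbour.
  have key : ∀ w, ∀ z (hz : ¬ IsLeaf T z), (z = w ∨ IsLeaf T w ∧ T.Adj w z) →
      (T.induce {v | ¬ IsLeaf T v}).Reachable ⟨a, ha⟩ ⟨z, hz⟩ := by
    refine forall_of_connected h.isTree.connected (a := a) ?_ ?_
    · rintro z hz (rfl | ⟨hl, -⟩)
      · exact SimpleGraph.Reachable.refl _
      · exact absurd hl ha
    · rintro u v huv ih z hz (rfl | ⟨hv, hvz⟩)
      · by_cases hu : IsLeaf T u
        · exact ih z hz (Or.inr ⟨hu, huv⟩)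
        · have hadj : (T.induce {v | ¬ IsLeaf T v}).Adj ⟨u, hu⟩ ⟨z, hz⟩ := huv
          exact (ih u hu (Or.inl rfl)).trans hadj.reachable
      · exact ih z hz (Or.inl (hv.eq_of_adj hvz huv.symm))
  exact fun u v => (key u.1 u.1 u.2 (Or.inl rfl)).symm.trans (key v.1 v.1 v.2 (Or.inl rfl))

theorem exists_pendants (h : HalinPresentation T G x) {a b : V} (ha : ¬ IsLeaf T a)
    (hb : ¬ IsLeaf T b) (hab : a ≠ b) :
    ∃ p p' q q', p ≠ p' ∧ IsPendant T p q ∧ IsPendant T p' q' := by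
  classical
  have : Nontrivial ({v | ¬ IsLeaf T v} : Set V) :=
    ⟨⟨a, ha⟩, ⟨b, hb⟩, fun e => hab (congrArg Subtype.val e)⟩
  have key : ∀ u : ({v | ¬ IsLeaf T v} : Set V), (T.induce {v | ¬ IsLeaf T v}).degree u = 1 →
      ∃ q, IsPendant T u.1 q := by
    intro u hu
    obtain ⟨q, hq, huniq⟩ := SimpleGraph.degree_eq_one_iff_existsUnique_adj.1 hu
    refine ⟨q.1, u.2, q.2, hq, fun r hr hne => ?_⟩
    by_contra hrl
    exact hne (congrArg Subtype.val (huniq ⟨r, hrl⟩ hr))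
  obtain ⟨u, v, huv, hu, hv⟩ := h.isTree_induce_inner.exists_ne_and_degree_eq_one
  obtain ⟨q, hq⟩ := key u hu
  obtain ⟨q', hq'⟩ := key v hv
  exact ⟨u.1, v.1, q, q', fun e => huv (Subtype.ext e), hq, hq'⟩

/-- The leaves at a pendant inner vertex `p` form an arc of the leaf cycle which starts with two
leaves `x i`, `x (i + 1)`. If two leaves are not adjacent to `p`, then the two leaves before the
arc are not. -/
theorem IsPendant.exists_fan (h : HalinPresentation T G x) {p q : V} (hp : IsPendant T p q)
    {j k : ℤ} (hjk : x j ≠ x k) (hj : ¬ T.Adj (x j) p) (hk : ¬ T.Adj (x k) p) :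
    ∃ i, T.Adj (x i) p ∧ T.Adj (x (i + 1)) p ∧ ¬ T.Adj (x (i - 1)) p ∧ ¬ T.Adj (x (i - 2)) p := by
  obtain ⟨i, e, h0, h1, hstep⟩ := h.fan p q hp.inner hp.inner' hp.adj hp.isLeaf_of_adj
  -- Otherwise `x (i - 1)` is the last leaf of the arc, which then closes up to the whole cycle.
  have h2 : ¬ T.Adj (x (i - 1)) p := by
    intro h2
    have he : x (i - 1) = e := by
      by_contra he
      exact (hstep _ h2 he).2 (by rw [sub_add_cancel])
    refine hj (h.forall_of_step (Q := fun v => T.Adj v p) h0 (fun m hm => ?_) j)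
    by_cases hme : x m = e
    · rw [← he, h.eq_iff] at hme
      rw [(h.eq_iff (m + 1) i).2 (by rw [show m + 1 - i = m - (i - 1) by ring]; exact hme)]
      exact h0
    · exact (hstep m hm hme).1
  refine ⟨i, h0, h1, h2, fun h3 => ?_⟩
  -- Otherwise `x (i - 2)` is the last leaf of the arc, and `x (i - 1)` is the only leaf outside it.
  have he : x (i - 2) = e := by
    by_contra he
    refine h2 ?_
    have := (hstep _ h3 he).1
    rwa [show i - 2 + 1 = i - 1 by ring] at this
  have hall := h.forall_of_step (Q := fun v => T.Adj v p ∨ v = x (i - 1)) (Or.inl h0) (by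
    rintro m (hm | hm)
    · by_cases hme : x m = e
      · right
        rw [← he, h.eq_iff] at hme
        rw [h.eq_iff, show m + 1 - (i - 1) = m - (i - 2) by ring]
        exact hme
      · exact Or.inl (hstep m hm hme).1
    · left
      rw [h.eq_iff] at hm
      rw [(h.eq_iff (m + 1) i).2 (by rw [show m + 1 - i = m - (i - 1) by ring]; exact hm)]
      exact h0)
  exact hjk (((hall j).resolve_left hj).trans ((hall k).resolve_left hk).symm)

/-! ### Trees with two inner vertices -/

theorem eq_or_eq_of_inner (h : HalinPresentation T G x) {p p' : V} (hp : IsPendant T p p')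
    (hp' : IsPendant T p' p) {v : V} (hv : ¬ IsLeaf T v) : v = p ∨ v = p' := by
  have hall : ∀ v, v = p ∨ v = p' ∨ (IsLeaf T v ∧ (T.Adj v p ∨ T.Adj v p')) := by
    refine forall_of_connected h.isTree.connected (Or.inl rfl) ?_
    rintro u v huv (rfl | rfl | ⟨hu, hup | hup⟩)
    · by_cases hv : IsLeaf T v
      · exact Or.inr (Or.inr ⟨hv, Or.inl huv.symm⟩)
      · exact Or.inr (Or.inl (hp.eq_of_adj huv hv))
    · by_cases hv : IsLeaf T v
      · exact Or.inr (Or.inr ⟨hv, Or.inr huv.symm⟩)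
      · exact Or.inl (hp'.eq_of_adj huv hv)
    · exact Or.inl (hu.eq_of_adj huv hup)
    · exact Or.inr (Or.inl (hu.eq_of_adj huv hup))
  rcases hall v with e | e | ⟨e, -⟩
  · exact Or.inl e
  · exact Or.inr e
  · exact absurd e hv

/-- The vertices of a double star: the two centres `p`, `p'`, then the leaves from `x i` on. -/
def doubleStarVertex (x : ℤ → V) (L : ℕ) (p p' : V) (i : ℤ) : Fin (L + 2) → V :=
  Fin.cons p (Fin.cons p' fun m : Fin L => x (i + m))

theorem bijective_doubleStarVertex (h : HalinPresentation T G x) {p p' : V}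
    (hp : IsPendant T p p') (hp' : IsPendant T p' p) (i : ℤ) {L : ℕ} (hL : leafCount T = L) :
    Function.Bijective (doubleStarVertex x L p p' i) := by
  constructor
  · unfold doubleStarVertex
    rw [Fin.cons_injective_iff, Fin.cons_injective_iff]
    refine ⟨?_, ?_, fun m n hmn => ?_⟩
    · rintro ⟨m, hm⟩
      refine Fin.cases ?_ (fun m => ?_) m hm
      · intro e
        exact hp.adj.ne e.symm
      · intro e
        exact h.inner_ne hp.inner _ e.symm
    · rintro ⟨m, hm⟩
      exact h.inner_ne hp'.inner _ hm.symm
    · by_contra hne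
      have := m.2
      have := n.2
      rcases lt_or_gt_of_ne (Fin.val_ne_of_ne hne) with hlt | hlt
      · exact h.ne_of_lt (by omega) (by omega) hmn
      · exact h.ne_of_lt (by omega) (by omega) hmn.symm
  · intro v
    by_cases hv : IsLeaf T v
    · obtain ⟨k, rfl⟩ := (h.isLeaf_iff v).1 hv
      obtain ⟨m, hm, e⟩ := h.exists_lt_eq i k
      exact ⟨Fin.succ (Fin.succ ⟨m, hL ▸ hm⟩), e.symm⟩
    · rcases h.eq_or_eq_of_inner hp hp' hv with rfl | rfl
      · exact ⟨0, rfl⟩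
      · exact ⟨1, rfl⟩

/-- To compare two graphs it suffices to compare the neighbourhoods of all vertices but two, if
these two are adjacent in both graphs. -/
theorem nonempty_iso_of_rows {V : Type*} {G : SimpleGraph V} {n : ℕ}
    {H : SimpleGraph (Fin (n + 2))} {φ : Fin (n + 2) → V}
    (hφ : Function.Bijective φ) (h01 : G.Adj (φ 0) (φ 1)) (h01' : H.Adj 0 1)
    (hrow : ∀ a : Fin n, ∀ b, G.Adj (φ a.succ.succ) (φ b) ↔ H.Adj a.succ.succ b) :
    Nonempty (G ≃g H) := by
  have hall : ∀ a b, G.Adj (φ a) (φ b) ↔ H.Adj a b := by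
    intro a b
    refine Fin.cases ?_ (Fin.cases ?_ fun a => ?_) a
    · refine Fin.cases ?_ (Fin.cases ?_ fun b => ?_) b
      · simp
      · exact iff_of_true h01 h01'
      · rw [G.adj_comm, H.adj_comm, hrow]
    · refine Fin.cases ?_ (Fin.cases ?_ fun b => ?_) b
      · exact iff_of_true h01.symm h01'.symm
      · simp
      · rw [G.adj_comm, H.adj_comm, hrow]
    · exact hrow a b
  exact ⟨RelIso.symm ⟨Equiv.ofBijective φ hφ, hall _ _⟩⟩

instance : DecidableRel H3.Adj := fun a b =>
  decidable_of_iff (s(a, b) ∈ ({s(0, 1), s(0, 2), s(0, 3), s(1, 4), s(1, 5),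
    s(2, 3), s(3, 4), s(4, 5), s(5, 2)} : Finset (Sym2 (Fin 6))) ∧ a ≠ b) (by simp [H3])

instance : DecidableRel H7.Adj := fun a b =>
  decidable_of_iff (s(a, b) ∈ ({s(0, 1), s(0, 2), s(0, 3), s(0, 4), s(1, 5), s(1, 6),
    s(2, 3), s(3, 4), s(4, 5), s(5, 6), s(6, 2)} : Finset (Sym2 (Fin 7))) ∧ a ≠ b) (by simp [H7])

/-- The row of a leaf in the adjacency matrix, in terms of the positions of its neighbours. -/
theorem adj_leaf_apply_iff (h : HalinPresentation T G x) {n : ℕ} {φ : Fin n → V}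
    (hφ : Function.Injective φ) {i : ℤ} {c c₁ c₂ : Fin n} (hc : T.Adj (x i) (φ c))
    (h1 : φ c₁ = x (i - 1)) (h2 : φ c₂ = x (i + 1)) (b : Fin n) :
    G.Adj (x i) (φ b) ↔ b = c ∨ b = c₁ ∨ b = c₂ := by
  rw [h.adj_leaf_iff hc, ← h1, ← h2, hφ.eq_iff, hφ.eq_iff, hφ.eq_iff]

theorem nonempty_iso_H3 (h : HalinPresentation T G x) {p p' : V}
    (hp : IsPendant T p p') (hp' : IsPendant T p' p) (hL : leafCount T = 4) {i : ℤ}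
    (h0 : T.Adj (x i) p) (h1 : T.Adj (x (i + 1)) p) (h2 : T.Adj (x (i + 2)) p')
    (h3 : T.Adj (x (i + 3)) p') : Nonempty (G ≃g H3) := by
  have hφ := h.bijective_doubleStarVertex hp hp' i hL
  have hwrap : ∀ a b : ℤ, (4 : ℤ) ∣ a - b → x a = x b := fun a b hab => by
    rw [h.eq_iff, hL]
    exact hab
  refine nonempty_iso_of_rows hφ ((h.adj_inner_iff hp.inner _).2 hp.adj) (by decide) fun a b => ?_
  show G.Adj (x (i + (a : ℕ))) _ ↔ _
  fin_cases a
  · rw [h.adj_leaf_apply_iff hφ.1 (c := 0) (c₁ := 5) (c₂ := 3)]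
    · revert b; decide
    · exact (by simpa using h0 : T.Adj (x (i + ((0 : ℕ) : ℤ))) p)
    · exact hwrap _ _ (by push_cast; ring_nf; decide)
    · exact hwrap _ _ (by push_cast; ring_nf; decide)
  · rw [h.adj_leaf_apply_iff hφ.1 (c := 0) (c₁ := 2) (c₂ := 4)]
    · revert b; decide
    · exact h1
    · exact hwrap _ _ (by push_cast; ring_nf; decide)
    · exact hwrap _ _ (by push_cast; ring_nf; decide)
  · rw [h.adj_leaf_apply_iff hφ.1 (c := 1) (c₁ := 3) (c₂ := 5)]
    · revert b; decide
    · exact h2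
    · exact hwrap _ _ (by push_cast; ring_nf; decide)
    · exact hwrap _ _ (by push_cast; ring_nf; decide)
  · rw [h.adj_leaf_apply_iff hφ.1 (c := 1) (c₁ := 4) (c₂ := 2)]
    · revert b; decide
    · exact h3
    · exact hwrap _ _ (by push_cast; ring_nf; decide)
    · exact hwrap _ _ (by push_cast; ring_nf; decide)

theorem nonempty_iso_H7 (h : HalinPresentation T G x) {p p' : V}
    (hp : IsPendant T p p') (hp' : IsPendant T p' p) (hL : leafCount T = 5) {i : ℤ}
    (h0 : T.Adj (x i) p) (h1 : T.Adj (x (i + 1)) p) (h2 : T.Adj (x (i + 2)) p)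
    (h3 : T.Adj (x (i + 3)) p') (h4 : T.Adj (x (i + 4)) p') : Nonempty (G ≃g H7) := by
  have hφ := h.bijective_doubleStarVertex hp hp' i hL
  have hwrap : ∀ a b : ℤ, (5 : ℤ) ∣ a - b → x a = x b := fun a b hab => by
    rw [h.eq_iff, hL]
    exact hab
  refine nonempty_iso_of_rows hφ ((h.adj_inner_iff hp.inner _).2 hp.adj) (by decide) fun a b => ?_
  show G.Adj (x (i + (a : ℕ))) _ ↔ _
  fin_cases a
  · rw [h.adj_leaf_apply_iff hφ.1 (c := 0) (c₁ := 6) (c₂ := 3)]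
    · revert b; decide
    · exact (by simpa using h0 : T.Adj (x (i + ((0 : ℕ) : ℤ))) p)
    · exact hwrap _ _ (by push_cast; ring_nf; decide)
    · exact hwrap _ _ (by push_cast; ring_nf; decide)
  · rw [h.adj_leaf_apply_iff hφ.1 (c := 0) (c₁ := 2) (c₂ := 4)]
    · revert b; decide
    · exact h1
    · exact hwrap _ _ (by push_cast; ring_nf; decide)
    · exact hwrap _ _ (by push_cast; ring_nf; decide)
  · rw [h.adj_leaf_apply_iff hφ.1 (c := 0) (c₁ := 3) (c₂ := 5)]
    · revert b; decide
    · exact h2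
    · exact hwrap _ _ (by push_cast; ring_nf; decide)
    · exact hwrap _ _ (by push_cast; ring_nf; decide)
  · rw [h.adj_leaf_apply_iff hφ.1 (c := 1) (c₁ := 4) (c₂ := 6)]
    · revert b; decide
    · exact h3
    · exact hwrap _ _ (by push_cast; ring_nf; decide)
    · exact hwrap _ _ (by push_cast; ring_nf; decide)
  · rw [h.adj_leaf_apply_iff hφ.1 (c := 1) (c₁ := 5) (c₂ := 2)]
    · revert b; decide
    · exact h4
    · exact hwrap _ _ (by push_cast; ring_nf; decide)
    · exact hwrap _ _ (by push_cast; ring_nf; decide)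

/-- Positive curvature leaves two Halin graphs with more than one inner vertex. The pendant inner
vertices `p`, `p'` each carry an arc of the leaf cycle; the curvature at the ends of both arcs
bounds the length of the cycle by five and forces `p` and `p'` to be adjacent. -/
theorem nonempty_iso_of_two_inner (h : HalinPresentation T G x)
    (hpos : HasPositiveLLYCurvature G) {a b : V} (ha : ¬ IsLeaf T a) (hb : ¬ IsLeaf T b)
    (hab : a ≠ b) : Nonempty (G ≃g H3) ∨ Nonempty (G ≃g H7) := by
  obtain ⟨p, p', q, q', hne, hp, hp'⟩ := h.exists_pendants ha hb hab
  have h3 := h.three_le_leafCount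
  have hdisj : ∀ {m : ℤ}, T.Adj (x m) p → ¬ T.Adj (x m) p' := fun h1 h2 =>
    hne (h.parent_eq h1 h2)
  obtain ⟨j₀, -, hj0, hj1, -⟩ := h.fan p' q' hp'.inner hp'.inner' hp'.adj hp'.isLeaf_of_adj
  obtain ⟨i, i0, i1, i2, i3⟩ := hp.exists_fan h (h.ne_of_lt (lt_add_one j₀) (by omega))
    (fun h' => hdisj h' hj0) (fun h' => hdisj h' hj1)
  obtain ⟨j, j0, j1, j2, j3⟩ := hp'.exists_fan h (h.ne_of_lt (lt_add_one i) (by omega))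
    (hdisj i0) (hdisj i1)
  have h5 := h.leafCount_le_five hpos i0 i1 i2 i3
  have hwrap : ∀ {a b : ℤ}, ((leafCount T : ℕ) : ℤ) ∣ a - b → x a = x b := (h.eq_iff _ _).2
  have hL3 : leafCount T ≠ 3 := fun hL => i3 (by
    rw [hwrap (a := i - 2) (b := i + 1) (by rw [hL]; ring_nf; decide)]
    exact i1)
  obtain ⟨m, hm, hjm⟩ := h.exists_lt_eq i j
  have hjm1 : x (j + 1) = x (i + m + 1) := by
    rw [h.eq_iff] at hjm ⊢
    rwa [add_sub_add_right_eq_sub]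
  have hjm' : x (j - 1) = x (i + m - 1) := by
    rw [h.eq_iff] at hjm ⊢
    rwa [sub_sub_sub_cancel_right]
  rw [hjm] at j0
  rw [hjm1] at j1
  rw [hjm'] at j2
  have hm0 : m ≠ 0 := by
    rintro rfl
    exact hdisj i0 (by simpa using j0)
  have hm1 : m ≠ 1 := by
    rintro rfl
    exact hdisj i1 (by simpa using j0)
  have hmL : m ≠ leafCount T - 1 := by
    intro hmL
    refine hdisj i0 ?_
    rw [hwrap (a := i) (b := i + m + 1)]
    · exact j1
    · rw [show i - (i + m + 1) = -(leafCount T : ℤ) by omega, dvd_neg]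
  rcases (show leafCount T = 4 ∨ leafCount T = 5 by omega) with hL | hL
  · -- With four leaves there is no room for a third inner vertex.
    left
    obtain rfl : m = 2 := by omega
    have hinner := ncard_inner_add_two_le h.isTree h.inner_degree
    have hsub : ({p, p'} : Set V) ⊆ {v | ¬ IsLeaf T v} := by
      rintro v (rfl | rfl)
      · exact hp.inner
      · exact hp'.inner
    have heq := Set.eq_of_subset_of_ncard_le hsub (by rw [Set.ncard_pair hne]; omega)
    have hq : q ∈ ({p, p'} : Set V) := heq ▸ hp.inner'
    have hq' : q' ∈ ({p, p'} : Set V) := heq ▸ hp'.inner'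
    obtain rfl : q = p' := hq.resolve_left hp.adj.ne'
    obtain rfl : q' = p := hq'.resolve_right hp'.adj.ne'
    exact h.nonempty_iso_H3 hp hp' hL i0 i1 j0 (by rwa [add_assoc] at j1)
  · right
    obtain ⟨r, hr⟩ := h.exists_parent (i - 1)
    obtain ⟨r', hr'⟩ := h.exists_parent (j - 1)
    obtain rfl : r = q := hp.eq_of_adj (h.adj_of_fan hpos hL.ge i0 i1 i2 i3 hr)
      (h.inner_of_adj _ _ hr)
    obtain rfl : r' = q' := hp'.eq_of_adj (h.adj_of_fan hpos hL.ge (by rwa [hjm]) (by rwa [hjm1])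
      (by rwa [hjm']) j3 hr') (h.inner_of_adj _ _ hr')
    rw [hjm'] at hr'
    have hi4 : x (i - 1) = x (i + 4) := hwrap (by rw [hL]; ring_nf; decide)
    rw [hi4] at hr
    rcases (show m = 2 ∨ m = 3 by omega) with rfl | rfl
    · -- The arc of `p'` follows that of `p` at once, so the remaining leaf is at `p'`.
      obtain rfl : p = r' := h.parent_eq i1 (by
        rwa [show i + ((2 : ℕ) : ℤ) - 1 = i + 1 by push_cast; ring] at hr')
      obtain rfl : p' = r := hp.eq_of_adj hp'.adj.symm hp'.inner
      refine h.nonempty_iso_H7 hp' hp hL (i := i + 2) j0 j1 ?_ ?_ ?_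
      · rwa [show i + 2 + 2 = i + 4 by ring]
      · rwa [hwrap (a := i + 2 + 3) (b := i) (by rw [hL]; ring_nf; decide)]
      · rwa [hwrap (a := i + 2 + 4) (b := i + 1) (by rw [hL]; ring_nf; decide)]
    · -- The arc of `p` follows that of `p'` at once, so the remaining leaf is at `p`.
      rw [show i + ((3 : ℕ) : ℤ) + 1 = i + 4 by push_cast; ring] at j1
      obtain rfl : p' = r := h.parent_eq j1 hr
      obtain rfl : p = r' := hp'.eq_of_adj hp.adj.symm hp.inner
      exact h.nonempty_iso_H7 hp hp' hL i0 i1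
        (by rwa [show i + ((3 : ℕ) : ℤ) - 1 = i + 2 by push_cast; ring] at hr') j0 j1

/-! ### Stars -/

/-- The spokes of a wheel whose rim has at least twelve vertices have nonpositive curvature. -/
theorem leafCount_le_eleven (h : HalinPresentation T G x) (hpos : HasPositiveLLYCurvature G)
    {p : V} (hp : ∀ i, T.Adj (x i) p) (hinner : ∀ v, ¬ IsLeaf T v → v = p) :
    leafCount T ≤ 11 := by
  classical
  by_contra! hL
  have hpi := h.inner_of_adj 0 p (hp 0)
  have hpx := h.inner_ne hpi
  let A : V → Prop := fun v => v = x (-1) ∨ v = x 0 ∨ v = x 1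
  let B : V → Prop := fun v => v = x (-2) ∨ v = x 2 ∨ v = p
  -- `f` is the distance to the arc `x (-1)`, `x 0`, `x 1` of the rim.
  let f : V → ℝ := fun v => if A v then 0 else if B v then 1 else 2
  have hfA : ∀ v, A v → f v = 0 := fun v hv => by simp only [f, hv, if_true]
  have hf_le : ∀ v, f v ≤ 2 := fun v => by
    simp only [f]
    split_ifs <;> norm_num
  have hf_nonneg : ∀ v, 0 ≤ f v := fun v => by
    simp only [f]
    split_ifs <;> norm_num
  have hf_ge : ∀ v, ¬ A v → 1 ≤ f v := fun v hv => by
    simp only [f, hv, if_false]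
    split_ifs <;> norm_num
  have hB : ∀ v, B v → f v ≤ 1 := fun v hv => by
    simp only [f, hv]
    split_ifs <;> norm_num
  have hpA : ¬ A p := by
    rintro (e | e | e) <;> exact hpx _ e
  have hfp : f p = 1 := le_antisymm (hB p (Or.inr (Or.inr rfl))) (hf_ge p hpA)
  have hlip : ∀ u v, G.Adj u v → f v - f u ≤ 1 := by
    intro u v huv
    by_cases hu : A u
    · have hv : f v ≤ 1 := by
        have hcases : A v ∨ B v := by
          rcases hu with rfl | rfl | rfl
          · rcases (h.adj_leaf_iff (hp _) v).1 huv with rfl | rfl | rfl <;> simp [A, B]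
          · rcases (h.adj_leaf_iff (hp _) v).1 huv with rfl | rfl | rfl <;> simp [A, B]
          · rcases (h.adj_leaf_iff (hp _) v).1 huv with rfl | rfl | rfl <;> simp [A, B]
        rcases hcases with hv | hv
        · rw [hfA v hv]
          norm_num
        · exact hB v hv
      linarith [hf_nonneg u]
    · linarith [hf_ge u hu, hf_le v]
  have hx0 : f (x 0) = 0 := hfA _ (Or.inr (Or.inl rfl))
  have key := hpos.laplacian_lt h.connected ((h.adj_leaf_iff (hp 0) p).2 (Or.inl rfl)) hlip
    (by rw [hx0, hfp]; norm_num)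
  rw [h.laplacian_leaf (hp 0), hx0, hfp, hfA (x (0 - 1)) (by simp [A]),
    hfA (x (0 + 1)) (by simp [A])] at key
  have hpadj : ∀ v, G.Adj p v ↔ IsLeaf T v := by
    intro v
    rw [h.adj_inner_iff hpi]
    constructor
    · intro hv
      by_contra hl
      exact hv.ne (hinner v hl).symm
    · intro hv
      obtain ⟨i, rfl⟩ := (h.isLeaf_iff v).1 hv
      exact (hp i).symm
  have hdeg : (G.degree p : ℝ) = leafCount T := by
    rw [degree_eq_ncard, leafCount]
    congr 2
    ext v
    exact hpadj v
  have hcount : ∑ v, (if G.Adj p v then (1 : ℝ) else 0) = G.degree p := by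
    rw [Finset.sum_boole, ← G.card_neighborFinset_eq_degree, G.neighborFinset_eq_filter]
  have hind : ∀ v w : V, (0 : ℝ) ≤ if v = w then 1 else 0 := fun v w => by
    split_ifs <;> norm_num
  have hind_one : ∀ v w : V, v = w → (if v = w then (1 : ℝ) else 0) = 1 := fun v w e => if_pos e
  -- All but five of the leaves have value two.
  have hsum : (leafCount T : ℝ) - 8 ≤ ∑ v, if G.Adj p v then f v - f p else 0 := by
    have hpt : ∀ v, (if G.Adj p v then (1 : ℝ) else 0) -
        (2 * (if v = x (-1) then 1 else 0) + 2 * (if v = x 0 then 1 else 0) +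
          2 * (if v = x 1 then 1 else 0) + (if v = x (-2) then 1 else 0) +
          (if v = x 2 then 1 else 0)) ≤ if G.Adj p v then f v - f p else 0 := by
      intro v
      rw [hfp]
      by_cases hv : G.Adj p v
      · rw [if_pos hv, if_pos hv]
        by_cases hA : A v
        · rw [hfA v hA]
          rcases hA with e | e | e <;>
            linarith [hind v (x (-1)), hind v (x 0), hind v (x 1), hind v (x (-2)),
              hind v (x 2), hind_one _ _ e]
        · by_cases hBv : B v
          · have := hf_ge v hA
            rcases hBv with e | e | e
            · linarith [hind v (x (-1)), hind v (x 0), hind v (x 1), hind v (x 2),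
                hind_one _ _ e]
            · linarith [hind v (x (-1)), hind v (x 0), hind v (x 1), hind v (x (-2)),
                hind_one _ _ e]
            · exact absurd e hv.ne'
          · have : f v = 2 := by simp only [f, hA, hBv, if_false]
            linarith [hind v (x (-1)), hind v (x 0), hind v (x 1), hind v (x (-2)),
              hind v (x 2)]
      · rw [if_neg hv, if_neg hv]
        linarith [hind v (x (-1)), hind v (x 0), hind v (x 1), hind v (x (-2)), hind v (x 2)]
    have := Finset.sum_le_sum fun v (_ : v ∈ Finset.univ) => hpt v
    simp only [Finset.sum_sub_distrib, Finset.sum_add_distrib, ← Finset.mul_sum,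
      Finset.sum_ite_eq', Finset.mem_univ, if_true, hcount, hdeg] at this
    linarith
  have hlap : laplacian G f p = (∑ v, if G.Adj p v then f v - f p else 0) / leafCount T := by
    rw [← hdeg]
    unfold laplacian
    congr!
  have hL' : (12 : ℝ) ≤ leafCount T := by exact_mod_cast hL
  rw [hlap, div_lt_iff₀ (by linarith)] at key
  linarith

theorem nonempty_iso_wheelGraph (h : HalinPresentation T G x) {p : V} (hp : ∀ i, T.Adj (x i) p)
    (hinner : ∀ v, ¬ IsLeaf T v → v = p) : Nonempty (G ≃g wheelGraph (leafCount T + 1)) := by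
  have hL := h.three_le_leafCount
  have hpi := h.inner_of_adj 0 p (hp 0)
  let φ : Option (Fin (leafCount T)) → V := fun u => u.elim p fun m => x (m : ℕ)
  have hinj : Function.Injective φ := by
    rintro (_ | m) (_ | n) hmn
    · rfl
    · exact absurd hmn (h.inner_ne hpi _)
    · exact absurd hmn.symm (h.inner_ne hpi _)
    · by_contra hne
      have := m.2
      have := n.2
      have hne' : (m : ℕ) ≠ n := fun e => hne (congrArg some (Fin.ext e))
      rcases lt_or_gt_of_ne hne' with hlt | hlt
      · exact h.ne_of_lt (by omega) (by omega) hmn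
      · exact h.ne_of_lt (by omega) (by omega) hmn.symm
  have hsurj : Function.Surjective φ := by
    intro v
    by_cases hv : IsLeaf T v
    · obtain ⟨k, rfl⟩ := (h.isLeaf_iff v).1 hv
      obtain ⟨m, hm, e⟩ := h.exists_lt_eq 0 k
      exact ⟨some ⟨m, hm⟩, by rw [e, zero_add]; rfl⟩
    · exact ⟨none, (hinner v hv).symm⟩
  have hspoke : ∀ m : Fin (leafCount T), (wheelGraph (leafCount T + 1)).Adj (some m) none :=
    fun m => ⟨by simp, Or.inr trivial⟩
  have hsub : ∀ m n : Fin (leafCount T),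
      x (m : ℕ) = x ((n : ℕ) + 1) ↔ (m - n).val = 1 := by
    intro m n
    rw [h.eq_iff]
    have h1 := Fin.intCast_val_sub_eq_sub_add_ite m n
    have h2 : (leafCount T : ℤ) ∣ (m : ℕ) - ((n : ℕ) + 1) ↔
        (leafCount T : ℤ) ∣ ((m - n).val : ℤ) - 1 := by
      rw [h1]
      split_ifs
      · rw [Nat.cast_zero, add_zero, sub_sub]
      · rw [← dvd_add_self_right]
        ring_nf
    rw [h2]
    constructor
    · intro hd
      have := (m - n).2
      have := Int.eq_zero_of_abs_lt_dvd hd (by rw [abs_lt]; omega)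
      omega
    · intro e
      rw [e]
      simp
  have hrim : ∀ m n : Fin (leafCount T), G.Adj (x (m : ℕ)) (x (n : ℕ)) ↔
      (SimpleGraph.cycleGraph (leafCount T)).Adj m n := by
    intro m n
    rw [h.adj_leaf_iff (hp _), SimpleGraph.cycleGraph_adj', ← hsub, ← hsub,
      or_iff_right (h.inner_ne hpi _).symm]
    refine or_congr_left ?_
    rw [h.eq_iff, h.eq_iff, ← dvd_neg]
    ring_nf
  have hadj : ∀ u v, G.Adj (φ u) (φ v) ↔ (wheelGraph (leafCount T + 1)).Adj u v := by
    rintro (_ | m) (_ | n)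
    · simp
    · exact iff_of_true ((h.adj_inner_iff hpi _).2 (hp _).symm) (hspoke n).symm
    · exact iff_of_true ((h.adj_leaf_iff (hp _) _).2 (Or.inl rfl)) (hspoke m)
    · refine (hrim m n).trans ⟨fun hmn => ?_, ?_⟩
      · exact ⟨fun e => hmn.ne (Option.some_injective _ e), Or.inl hmn⟩
      · rintro ⟨-, hmn | hmn⟩
        · exact hmn
        · exact SimpleGraph.Adj.symm hmn
  exact ⟨RelIso.symm ⟨Equiv.ofBijective φ ⟨hinj, hsurj⟩, hadj _ _⟩⟩

end HalinPresentation

end HalinLLY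

theorem corollary1p4 {V : Type*} [Fintype V] (G : SimpleGraph V)
    (hG : HalinLLY.IsHalin G) (hpos : HalinLLY.HasPositiveLLYCurvature G) :
    (∃ n : ℕ, 4 ≤ n ∧ n ≤ 12 ∧ Nonempty (G ≃g HalinLLY.wheelGraph n)) ∨
      Nonempty (G ≃g HalinLLY.H3) ∨ Nonempty (G ≃g HalinLLY.H7) := by
  obtain ⟨T, x, h⟩ := hG.exists_presentation
  obtain ⟨p, hp⟩ := h.exists_inner
  by_cases hstar : ∀ v, ¬ HalinLLY.IsLeaf T v → v = p
  · have hadj : ∀ i, T.Adj (x i) p := fun i => by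
      obtain ⟨r, hr⟩ := h.exists_parent i
      rwa [← hstar r (h.inner_of_adj i r hr)]
    have h3 := h.three_le_leafCount
    have h11 := h.leafCount_le_eleven hpos hadj hstar
    exact Or.inl ⟨HalinLLY.leafCount T + 1, by omega, by omega,
      h.nonempty_iso_wheelGraph hadj hstar⟩
  · push Not at hstar
    obtain ⟨v, hv, hne⟩ := hstar
    exact Or.inr (h.nonempty_iso_of_two_inner hpos hv hp hne)
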